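/- Let $m\ge 2$ players hold a system with Hilbert space $\mathcal H=\bigotimes_{k=1}^m\mathbb C^{d_k}$ ($d_k\ge1$), let $n\ge2$, and let $\mathcal E=\{\eta_i,\rho_i\}_{i=0}^{n-1}$ be an ensemble of density operators on $\mathcal H$ ($\eta_i\ge0$, $\sum_i\eta_i=1$) that are mutually orthogonal, $\rho_i\rho_j=0$ for $i\ne j$. Assume that $\eta_0<\frac2n$ and that $$\eta_0\Gamma_{\mathsf X}(\rho_0)-\eta_i\Gamma_{\mathsf X}(\rho_i)\succeq0\qquad(i=1,\dots,n-1)$$ for every partition $\mathsf X$ of the set of players into two nonempty blocks, where $\Gamma_{\mathsf X}$ is the partial transposition on one of the two blocks. For a partition $\mathsf X$ of the set of players, an $\mathsf X$-LOCC measurement is a POVM realizable by finitely many rounds of local measurements on the blocks of $\mathsf X$ and classical communication among the blocks. For an ensemble $\mathcal F=\{\mu_i,\tau_i\}_{i=0}^{n-1}$ let $p_{\mathsf X}(\mathcal F)$ be the supremum of $\sum_i\mu_i\mathrm{Tr}(\tau_iM_i)$ over all $\mathsf X$-LOCC measurements $\{M_i\}_{i=0}^{n-1}$, and $p_{\mathsf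 G}(\mathcal F)$ the supremum over all POVMs $\{M_i\}_{i=0}^{n-1}$. For $L\ge1$ and $\vec c\in\{0,\dots,n-1\}^L$ put $\eta_{\vec c}=\prod_l\eta_{c_l}$, $\rho_{\vec c}=\bigotimes_l\rho_{c_l}$ (each player holding its $L$ subsystems) and $\omega(\vec c)=\sum_lc_l \bmod n$, and let $\mathcal E^{(L)}=\{\eta_i^{(L)},\rho_i^{(L)}\}_{i=0}^{n-1}$ with $\eta^{(L)}_i=\sum_{\omega(\vec c)=i}\eta_{\vec c}$ and $\eta_i^{(L)}\rho_i^{(L)}=\sum_{\omega(\vec c)=i}\eta_{\vec c}\rho_{\vec c}$ (where $\eta_i^{(L)}=0$, the choice of $\rho_i^{(L)}$ is immaterial). Consider the following scheme with parameter $L\ge1$ for hiding $x\in\{0,\dots,n-1\}$: a hider prepares $\rho_{\vec c}$ with probability $\eta_{\vec c}$, distributes it to the $m$ players, and broadcasts $z=x+\omega(\vec c)\bmod n$; the players guess $x$ by a measurement that may depend on $z$. Then this is an $m$-player data-hiding scheme for $n$-ary data: 1. For every $L\ge1$ there are global measurements (one for each $z$) that recover every $x$ with probability $1$. 2. For every partition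 $\mathsf X$ of the players into at least two blocks, the optimal average probability of guessing uniformly distributed $x$ by $\mathsf X$-LOCC measurements converges to $\frac1n$ as $L\to\infty$. Moreover, for every $L\ge1$: for every partition $\mathsf X$ the optimal average probability of guessing uniformly distributed $x$ by $\mathsf X$-LOCC measurements equals $p_{\mathsf X}(\mathcal E^{(L)})$; $p_{\mathsf G}(\mathcal E^{(L)})=1$; and the convergence is exponential: for every $\mathsf X$ with at least two blocks, $$\frac1n\le p_{\mathsf X}(\mathcal E^{(L)})\le\frac1n+\frac{n-1}n\,(n\eta_0-1)^L .$$ -/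

import Mathlib

noncomputable section

namespace DataHiding

open Filter Topology
open scoped ComplexOrder

/-! ### Multi-party systems -/

/-- Basis labels of the `m`-party space `⨂ₖ ℂ^(d k)`. -/
abbrev Idx {m : ℕ} (d : Fin m → ℕ) : Type := (k : Fin m) → Fin (d k)

/-- Linear operators on `⨂ₖ ℂ^(d k)`, as matrices in the product basis. -/
abbrev Op {m : ℕ} (d : Fin m → ℕ) : Type := Matrix (Idx d) (Idx d) ℂ

/-- Basis labels of the space `⨂_{k ∈ A} ℂ^(d k)` held jointly by a set `A` of players. -/
abbrev BlockIdx {m : ℕ} (A : Finset (Fin m)) (d : Fin m → ℕ) : Type := (k : A) → Fin (d k)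

/-- Partitions of the set of the `m` players into nonempty disjoint blocks. -/
abbrev Partition (m : ℕ) : Type := Finpartition (Finset.univ : Finset (Fin m))

/-- A bipartition has exactly two blocks. -/
def IsBipartition {m : ℕ} (X : Partition m) : Prop := X.parts.card = 2

/-- A partition is nontrivial if it has at least two blocks. -/
def IsNontrivial {m : ℕ} (X : Partition m) : Prop := 2 ≤ X.parts.card

/-! ### Measurements -/

/-- A measurement with outcomes `0, …, n - 1`: a positive operator-valued measure. -/
structure IsMeasurement {m n : ℕ} {d : Fin m → ℕ} (M : Fin n → Op d) : Prop where
  posSemidef : ∀ i, (M i).PosSemidef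
  sum_eq_one : ∑ i, M i = 1

/-- The set of all (global) measurements with outcomes `0, …, n - 1`. -/
def globalMeasurements {m : ℕ} (d : Fin m → ℕ) (n : ℕ) : Set (Fin n → Op d) :=
  {M | IsMeasurement M}

/-- The operator `K ⊗ 𝟙` that applies `K` to the systems of the players in `A` and the identity to
all other systems. `K` may change the dimensions of the systems in `A`; it is used only when
`d' k = d k` for `k ∉ A`. -/
def localOp {m : ℕ} {d d' : Fin m → ℕ} (A : Finset (Fin m))
    (K : Matrix (BlockIdx A d') (BlockIdx A d) ℂ) : Matrix (Idx d') (Idx d) ℂ :=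
  Matrix.of fun a b =>
    if ∀ k, k ∉ A → (a k : ℕ) = (b k : ℕ) then K (fun k => a k) (fun k => b k) else 0

/-- `IsLOCC X M`: the measurement `M` is realized by local operations on the blocks of `X` and
classical communication among them. A protocol either stops and announces an outcome (`output`),
or some block `A` of `X` performs a local measurement with Kraus operators `K s` (the dimensions
after the measurement may depend on its result `s`), the result `s` is communicated to everybody,
and the players go on with a protocol that depends on `s` (`round`). If `N s` is the measurement
realized by the rest of the protocol, then the whole protocol realizes
`M i = ∑ s, (K s ⊗ 𝟙)† (N s i) (K s ⊗ 𝟙)`. Local ancillas, local and shared randomness and the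
discarding of information are special cases. -/
inductive IsLOCC {m n : ℕ} (X : Partition m) : {d : Fin m → ℕ} → (Fin n → Op d) → Prop
  | output {d : Fin m → ℕ} (i : Fin n) : IsLOCC X (fun j => if j = i then (1 : Op d) else 0)
  | round {d : Fin m → ℕ} (A : Finset (Fin m)) (hA : A ∈ X.parts) (r : ℕ)
      (d' : Fin r → Fin m → ℕ) (hd' : ∀ s k, k ∉ A → d' s k = d k)
      (K : (s : Fin r) → Matrix (BlockIdx A (d' s)) (BlockIdx A d) ℂ)
      (hK : ∑ s, (K s).conjTranspose * K s = 1)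
      (N : (s : Fin r) → Fin n → Op (d' s)) (hN : ∀ s, IsLOCC X (N s)) :
      IsLOCC X (fun i => ∑ s, (localOp A (K s)).conjTranspose * N s i * localOp A (K s))

/-- The set of all `X`-LOCC measurements with outcomes `0, …, n - 1`. -/
def loccMeasurements {m : ℕ} (X : Partition m) (d : Fin m → ℕ) (n : ℕ) : Set (Fin n → Op d) :=
  {M | IsLOCC X M}

/-! ### State ensembles and their discrimination -/

/-- An ensemble of `n` states: the density operator `state i` is prepared with probability
`prob i`. -/
structure Ensemble {m : ℕ} (d : Fin m → ℕ) (n : ℕ) where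
  prob : Fin n → ℝ
  state : Fin n → Op d
  prob_nonneg : ∀ i, 0 ≤ prob i
  prob_sum : ∑ i, prob i = 1
  state_posSemidef : ∀ i, (state i).PosSemidef
  state_trace : ∀ i, (state i).trace = 1

/-- The states of the ensemble are mutually orthogonal. -/
def Ensemble.IsOrthogonal {m n : ℕ} {d : Fin m → ℕ} (E : Ensemble d n) : Prop :=
  ∀ i j, i ≠ j → E.state i * E.state j = 0

/-- The average probability `∑ᵢ ηᵢ Tr(ρᵢ Mᵢ)` of a correct guess. -/
def successProb {m n : ℕ} {d : Fin m → ℕ} (η : Fin n → ℝ) (ρ : Fin n → Op d)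
    (M : Fin n → Op d) : ℝ :=
  ∑ i, η i * (ρ i * M i).trace.re

/-- The optimal success probability over a class `S` of measurements: `p_X` for
`S = loccMeasurements X d n`, and `p_G` for `S = globalMeasurements d n`. -/
def optSuccess {m n : ℕ} {d : Fin m → ℕ} (S : Set (Fin n → Op d)) (η : Fin n → ℝ)
    (ρ : Fin n → Op d) : ℝ :=
  sSup (successProb η ρ '' S)

/-- Partial transposition on the systems of the players in `A`. -/
def partialTranspose {m : ℕ} {d : Fin m → ℕ} (A : Finset (Fin m)) (T : Op d) : Op d :=
  Matrix.of fun a b =>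
    T (fun k => if k ∈ A then b k else a k) (fun k => if k ∈ A then a k else b k)

/-- `η₀ Γ_X(ρ₀) - ηᵢ Γ_X(ρᵢ) ⪰ 0` for all `i ≠ 0`, for a bipartition `X`. The operation `Γ_X`
transposes one of the two blocks of `X`; which one is immaterial, since the two choices differ by
a full transposition, which preserves positivity. -/
def PTDominated {m n : ℕ} [NeZero n] {d : Fin m → ℕ} (E : Ensemble d n) (X : Partition m) :
    Prop :=
  ∃ A ∈ X.parts, ∀ i : Fin n, i ≠ 0 →
    ((E.prob 0 : ℂ) • partialTranspose A (E.state 0) -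
      (E.prob i : ℂ) • partialTranspose A (E.state i)).PosSemidef

/-! ### Multi-fold ensembles -/

/-- Local dimensions of `L` copies of the system: player `k` holds `(ℂ^(d k))^{⊗ L}`. -/
def foldDim {m : ℕ} (d : Fin m → ℕ) (L : ℕ) : Fin m → ℕ := fun k => d k ^ L

/-- The label of the `l`-th copy contained in a label of `L` copies. -/
def copyIdx {m : ℕ} {d : Fin m → ℕ} {L : ℕ} (a : Idx (foldDim d L)) (l : Fin L) : Idx d :=
  fun k => finFunctionFinEquiv.symm (a k) l

/-- `η_c = ∏ₗ η_{c l}`. -/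
def vecProb {n L : ℕ} (η : Fin n → ℝ) (c : Fin L → Fin n) : ℝ := ∏ l, η (c l)

/-- `ρ_c = ⨂ₗ ρ_{c l}`, as an operator of the `m` players, each holding `L` systems. -/
def vecState {m n L : ℕ} {d : Fin m → ℕ} (ρ : Fin n → Op d) (c : Fin L → Fin n) :
    Op (foldDim d L) :=
  Matrix.of fun a b => ∏ l, ρ (c l) (copyIdx a l) (copyIdx b l)

/-- The sum modulo `n` of the entries of `c` (addition in `Fin n` is modulo `n`). -/
def modSum {n L : ℕ} [NeZero n] (c : Fin L → Fin n) : Fin n := ∑ l, c l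

/-- `ηᵢ^(L)`: the total probability of the vectors `c` with sum `i` modulo `n`. -/
def foldProb {n : ℕ} [NeZero n] (η : Fin n → ℝ) (L : ℕ) (i : Fin n) : ℝ :=
  ∑ c : Fin L → Fin n with modSum c = i, vecProb η c

/-- `ρᵢ^(L)`: the average of the states `ρ_c` over the vectors `c` with sum `i` modulo `n`.
(If `ηᵢ^(L) = 0` this is the zero operator; it then enters with weight zero.) -/
def foldState {m n : ℕ} [NeZero n] {d : Fin m → ℕ} (η : Fin n → ℝ) (ρ : Fin n → Op d) (L : ℕ)
    (i : Fin n) : Op (foldDim d L) :=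
  ((foldProb η L i : ℂ))⁻¹ •
    ∑ c : Fin L → Fin n with modSum c = i, (vecProb η c : ℂ) • vecState ρ c

/-! ### Data-hiding schemes

A scheme hides data `x ∈ {0, …, n - 1}` by sending a quantum state to the players and broadcasting
a message `z ∈ {0, …, n - 1}`. It is given by the operators `σ x z`: if the data are `x`, then `z`
is broadcast with probability `Tr (σ x z)` and the players then share the state
`σ x z / Tr (σ x z)`. The players use a measurement `M z` that depends on `z`, and its outcome is
their guess of `x`. -/

/-- The probability that the strategy `M` guesses the data `x` correctly. -/
def recoverProb {m n : ℕ} {d : Fin m → ℕ} (σ : Fin n → Fin n → Op d)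
    (M : Fin n → Fin n → Op d) (x : Fin n) : ℝ :=
  ∑ z, (σ x z * M z x).trace.re

/-- The optimal average probability of guessing uniformly distributed data when the measurement
for each broadcast message has to belong to `S`. -/
def optRecover {m n : ℕ} {d : Fin m → ℕ} (S : Set (Fin n → Op d))
    (σ : Fin n → Fin n → Op d) : ℝ :=
  sSup ((fun M : Fin n → Fin n → Op d => (1 / (n : ℝ)) * ∑ x, recoverProb σ M x) ''
    {M | ∀ z, M z ∈ S})

/-- A sequence of schemes (indexed by `L = 1, 2, …`) is an `m`-player data-hiding scheme for
`n`-ary data if all the data are recovered with certainty by a global measurement, while the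
optimal probability of guessing them by non-global measurements tends to that of a random guess. -/
structure IsDataHidingScheme {m n : ℕ} (D : ℕ → Fin m → ℕ)
    (σ : (L : ℕ) → Fin n → Fin n → Op (D L)) : Prop where
  posSemidef : ∀ L, 1 ≤ L → ∀ x z, (σ L x z).PosSemidef
  trace_sum : ∀ L, 1 ≤ L → ∀ x, ∑ z, (σ L x z).trace = 1
  accessible : ∀ L, 1 ≤ L → ∃ M : Fin n → Fin n → Op (D L),
    (∀ z, M z ∈ globalMeasurements (D L) n) ∧ ∀ x, recoverProb (σ L) M x = 1
  hidden : ∀ X : Partition m, IsNontrivial X →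
    Tendsto (fun L => optRecover (loccMeasurements X (D L) n) (σ L)) atTop (𝓝 (1 / (n : ℝ)))

/-- The scheme built from an ensemble with `L` repetitions: the hider prepares `ρ_c` with
probability `η_c` and broadcasts `z = x + (sum of c)` modulo `n`. -/
def ensembleScheme {m n : ℕ} [NeZero n] {d : Fin m → ℕ} (E : Ensemble d n) (L : ℕ)
    (x z : Fin n) : Op (foldDim d L) :=
  ∑ c : Fin L → Fin n with x + modSum c = z, (vecProb E.prob c : ℂ) • vecState E.state c

end DataHiding

end

open DataHiding

noncomputable section

namespace DataHiding

open Filter Topology Matrix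
open scoped ComplexOrder

/-! ### Positive semidefinite matrices -/

section Matrices

/-! Put `q j = η_j ρ_j`. Guessing `x` from the state and `z` amounts to guessing `ω(c) = z - x`,
that is, to discriminating the operators `foldOp q L i`. These stay mutually orthogonal, so global
measurements are perfect.

For LOCC, split the indicator of `ω(c) = i` into its mean `1/n` and a deviation. The deviation is an
iterated convolution over the integers mod `n` and sums to zero over `i`, so adding to a tensor
factor an operator independent of `j` does not change it. Hence every factor `T j` may become `T j -
T 0` (`modDeviation_reflect`, `foldOp_eq`). For the partially transposed `T j` the differences `T 0
- T j` are positive, and since the deviation is at most `(n-1)/n` in absolute value, all `foldOp T L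
i` lie below one operator `foldBound T L` that does not depend on `i`.

LOCC elements stay positive under partial transposition on a union of blocks
(`IsLOCC.posSemidef_partialTranspose`), so LOCC success is at most the trace of `foldBound`
(`sum_trace_foldOp_le`), which is the claimed bound. Constant guesses give the lower bound `1/n`. -/

lemma posSemidef_real_smul {ι : Type*} {A : Matrix ι ι ℂ} (hA : A.PosSemidef) {r : ℝ} (hr : 0 ≤ r) :
    ((r : ℂ) • A).PosSemidef :=
  Matrix.PosSemidef.smul hA (by exact_mod_cast hr)

variable {ι : Type*} [Fintype ι]

/-- By the Schur product theorem `A ⊙ Bᵀ` is positive; its quadratic form at the all-ones vector is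
the trace. -/
lemma re_trace_mul_nonneg {A B : Matrix ι ι ℂ} (hA : A.PosSemidef) (hB : B.PosSemidef) :
    0 ≤ (A * B).trace.re := by
  have h := (hA.hadamard hB.transpose).dotProduct_mulVec_nonneg (fun _ => 1)
  have e : star (fun _ : ι => (1 : ℂ)) ⬝ᵥ ((A ⊙ Bᵀ) *ᵥ fun _ => 1) = (A * B).trace := by
    have := Matrix.sum_hadamard_eq A Bᵀ
    rw [transpose_transpose] at this
    rw [← this]
    simp [dotProduct, mulVec]
  rw [e] at h
  exact (Complex.le_def.1 h).1

/-- Iterated Schur product theorem. It serves for tensor products, which are entrywise products of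
factors pulled back along `copyIdx`. -/
lemma posSemidef_prod {κ : Type*} (s : Finset κ) (A : κ → Matrix ι ι ℂ)
    (hA : ∀ l ∈ s, (A l).PosSemidef) :
    (Matrix.of fun a b => ∏ l ∈ s, A l a b : Matrix ι ι ℂ).PosSemidef := by
  classical
  induction s using Finset.induction_on with
  | empty =>
    convert posSemidef_vecMulVec_self_star (fun _ : ι => (1 : ℂ)) using 1
    ext a b
    simp [vecMulVec_apply]
  | insert l s hl ih =>
    have h := (hA l (Finset.mem_insert_self l s)).hadamard
      (ih fun k hk => hA k (Finset.mem_insert_of_mem hk))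
    have e : (Matrix.of fun a b => ∏ k ∈ insert l s, A k a b : Matrix ι ι ℂ) =
        A l ⊙ Matrix.of fun a b => ∏ k ∈ s, A k a b := by
      ext a b
      simp [Finset.prod_insert hl]
    rw [e]
    exact h

/-- The projection onto the support of a Hermitian matrix is a multiple of it on both sides. -/
lemma exists_support_projection [DecidableEq ι] {Q : Matrix ι ι ℂ} (hQ : Q.IsHermitian) :
    ∃ P R : Matrix ι ι ℂ, P.IsHermitian ∧ P * P = P ∧ Q * P = Q ∧ P = Q * R ∧ P = R * Q := by
  set φ := Unitary.conjStarAlgAut ℂ (Matrix ι ι ℂ) hQ.eigenvectorUnitary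
  set D : Matrix ι ι ℂ := diagonal fun i => (hQ.eigenvalues i : ℂ)
  -- Since `0⁻¹ = 0`, the product `D * R` is the 0/1 indicator of the nonzero eigenvalues.
  set R : Matrix ι ι ℂ := diagonal fun i => (hQ.eigenvalues i : ℂ)⁻¹
  have hφ : Q = φ D := hQ.spectral_theorem
  have key : ∀ x : ℂ, x * (x * x⁻¹) = x := fun x => by
    by_cases hx : x = 0 <;> simp [hx]
  refine ⟨φ (D * R), φ R, ?_, ?_, ?_, ?_, ?_⟩
  · change star (φ (D * R)) = _
    rw [← map_star]
    congr 1
    simp only [D, R, diagonal_mul_diagonal, star_eq_conjTranspose, diagonal_conjTranspose]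
    congr 1
    ext i
    simp
  · rw [← map_mul]
    congr 1
    simp only [D, R, diagonal_mul_diagonal]
    congr 1
    ext i
    by_cases hx : (hQ.eigenvalues i : ℂ) = 0 <;> simp [hx]
  · rw [hφ, ← map_mul]
    congr 1
    simp only [D, R, diagonal_mul_diagonal, key]
  · rw [hφ, ← map_mul]
  · rw [hφ, ← map_mul]
    congr 1
    simp only [D, R, diagonal_mul_diagonal, mul_comm]

/-- Mutually orthogonal positive semidefinite matrices are told apart by a measurement. -/
lemma exists_discriminating_measurement [DecidableEq ι] {κ : Type*} [Fintype κ] [DecidableEq κ]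
    (k₀ : κ) (Q : κ → Matrix ι ι ℂ) (hQ : ∀ k, (Q k).IsHermitian)
    (horth : ∀ j k, j ≠ k → Q j * Q k = 0) :
    ∃ M : κ → Matrix ι ι ℂ, (∀ k, (M k).PosSemidef) ∧ ∑ k, M k = 1 ∧ ∀ k, Q k * M k = Q k := by
  choose P R hP hPP hQP hPR hRP using fun k => exists_support_projection (hQ k)
  have hPo : ∀ j k, j ≠ k → P j * P k = 0 := fun j k hjk => by
    rw [hRP j, hPR k, Matrix.mul_assoc, ← Matrix.mul_assoc (Q j), horth j k hjk]
    simp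
  have hQPo : ∀ j k, j ≠ k → Q j * P k = 0 := fun j k hjk => by
    rw [hPR k, ← Matrix.mul_assoc, horth j k hjk, Matrix.zero_mul]
  have psd : ∀ A : Matrix ι ι ℂ, A.IsHermitian → A * A = A → A.PosSemidef := fun A h1 h2 => by
    have := posSemidef_conjTranspose_mul_self A
    rwa [h1.eq, h2] at this
  set S := ∑ k, P k
  have hS : S.IsHermitian := by
    simp only [S, IsHermitian, conjTranspose_sum]
    exact Finset.sum_congr rfl fun k _ => hP k
  have hSS : S * S = S := by
    simp only [S, Finset.sum_mul, Finset.mul_sum]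
    refine Finset.sum_congr rfl fun j _ => ?_
    rw [Finset.sum_eq_single j (fun k _ hk => hPo k j hk) (by simp), hPP]
  have hcompl : (1 - S).PosSemidef := by
    refine psd _ (isHermitian_one.sub hS) ?_
    simp [sub_mul, mul_sub, hSS]
  -- The projections need not sum to `1`. The remainder `1 - S` goes to the outcome `k₀`,
  -- harmlessly, since every `Q k` annihilates it.
  refine ⟨fun k => P k + if k = k₀ then 1 - S else 0, fun k => ?_, ?_, fun k => ?_⟩
  · refine (psd _ (hP k) (hPP k)).add ?_
    split_ifs
    exacts [hcompl, PosSemidef.zero]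
  · simp [Finset.sum_add_distrib, S]
  · have : Q k * S = Q k := by
      simp only [S, Finset.mul_sum]
      rw [Finset.sum_eq_single k (fun j _ hj => hQPo k j hj.symm) (by simp), hQP]
    dsimp only
    split_ifs <;> simp [mul_add, mul_sub, hQP, this]

end Matrices

/-! ### Partial transposition and local operations -/

section PartialTranspose

variable {m : ℕ} {d : Fin m → ℕ}

/-- The label that agrees with `b` on `A` and with `a` elsewhere. -/
def mixIdx (A : Finset (Fin m)) (a b : Idx d) : Idx d := fun k => if k ∈ A then b k else a k

lemma partialTranspose_apply (A : Finset (Fin m)) (T : Op d) (a b : Idx d) :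
    partialTranspose A T a b = T (mixIdx A a b) (mixIdx A b a) := rfl

lemma mixIdx_self (A : Finset (Fin m)) (a : Idx d) : mixIdx A a a = a := by
  ext k
  simp [mixIdx]

lemma mixIdx_mixIdx (A : Finset (Fin m)) (a b : Idx d) :
    mixIdx A (mixIdx A a b) (mixIdx A b a) = a := by
  ext k
  simp only [mixIdx]
  split_ifs <;> rfl

/-- Exchanging the labels on `A` between two labels. -/
def mixEquiv (A : Finset (Fin m)) : Idx d × Idx d ≃ Idx d × Idx d :=
  Function.Involutive.toPerm (fun p => (mixIdx A p.1 p.2, mixIdx A p.2 p.1)) fun p => by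
    simp [mixIdx_mixIdx]

lemma partialTranspose_empty (T : Op d) : partialTranspose ∅ T = T := by
  ext a b
  simp [partialTranspose]

lemma partialTranspose_sum {κ : Type*} (A : Finset (Fin m)) (s : Finset κ) (T : κ → Op d) :
    partialTranspose A (∑ i ∈ s, T i) = ∑ i ∈ s, partialTranspose A (T i) := by
  ext a b
  simp [partialTranspose_apply, Matrix.sum_apply]

lemma partialTranspose_one (A : Finset (Fin m)) : partialTranspose A (1 : Op d) = 1 := by
  ext a b
  rw [partialTranspose_apply, one_apply, one_apply]
  congr 1
  simp only [eq_iff_iff, funext_iff, mixIdx]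
  refine forall_congr' fun k => ?_
  split_ifs
  exacts [eq_comm, Iff.rfl]

lemma trace_partialTranspose (A : Finset (Fin m)) (T : Op d) :
    (partialTranspose A T).trace = T.trace := by
  simp only [trace, diag, partialTranspose_apply]
  refine Finset.sum_congr rfl fun a _ => ?_
  rw [mixIdx_self]

/-- Exchanging the labels on `A` permutes the pairs `(a, b)` over which the trace sums. -/
lemma trace_partialTranspose_mul (A : Finset (Fin m)) (S T : Op d) :
    (partialTranspose A S * partialTranspose A T).trace = (S * T).trace := by
  simp only [trace, diag, mul_apply, partialTranspose_apply, ← Fintype.sum_prod_type']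
  exact Fintype.sum_equiv (mixEquiv A) _ _ fun _ => rfl

/-- The exchange leaves the labels read by `K` alone; off `B` it only moves the required equalities
between the two factors. Thus the product is invariant although the single factors are not. -/
lemma conj_localOp_mul_localOp_of_disjoint {d' : Fin m → ℕ} {A B : Finset (Fin m)}
    (h : Disjoint B A) (K : Matrix (BlockIdx B d') (BlockIdx B d) ℂ) (p q : Idx d')
    (a b : Idx d) :
    star (localOp B K (mixIdx A p q) (mixIdx A a b)) *
        localOp B K (mixIdx A q p) (mixIdx A b a) =
      star (localOp B K p a) * localOp B K q b := by
  have hr : ∀ {e : Fin m → ℕ} (x y : Idx e),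
      (fun k : B => mixIdx A x y k) = fun k : B => x k := fun x y => by
    funext k
    simp [mixIdx, Finset.disjoint_left.1 h k.2]
  have hc : ((∀ k, k ∉ B → (mixIdx A p q k : ℕ) = mixIdx A a b k) ∧
      (∀ k, k ∉ B → (mixIdx A q p k : ℕ) = mixIdx A b a k)) ↔
      ((∀ k, k ∉ B → (p k : ℕ) = a k) ∧ (∀ k, k ∉ B → (q k : ℕ) = b k)) := by
    simp only [← forall_and, mixIdx]
    refine forall_congr' fun k => ?_
    split_ifs <;> tauto
  simp only [localOp, of_apply, hr, apply_ite star, star_zero, ite_mul, mul_ite, zero_mul, mul_zero,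
    ← ite_and]
  exact if_congr (by tauto) rfl rfl

/-- Here the labels on `B` are exchanged, so the conjugated and the plain factor trade places: `K`
turns into its entrywise conjugate. -/
lemma conj_localOp_mul_localOp_of_subset {d' : Fin m → ℕ} {A B : Finset (Fin m)}
    (h : B ⊆ A) (K : Matrix (BlockIdx B d') (BlockIdx B d) ℂ) (p q : Idx d')
    (a b : Idx d) :
    star (localOp B K (mixIdx A p q) (mixIdx A a b)) *
        localOp B K (mixIdx A q p) (mixIdx A b a) =
      star (localOp B (K.map star) p a) * localOp B (K.map star) q b := by
  have hr : ∀ {e : Fin m → ℕ} (x y : Idx e),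
      (fun k : B => mixIdx A x y k) = fun k : B => y k := fun x y => by
    funext k
    simp [mixIdx, h k.2]
  have hc : ((∀ k, k ∉ B → (mixIdx A p q k : ℕ) = mixIdx A a b k) ∧
      (∀ k, k ∉ B → (mixIdx A q p k : ℕ) = mixIdx A b a k)) ↔
      ((∀ k, k ∉ B → (p k : ℕ) = a k) ∧ (∀ k, k ∉ B → (q k : ℕ) = b k)) := by
    simp only [← forall_and, mixIdx]
    refine forall_congr' fun k => ?_
    split_ifs <;> tauto
  simp only [localOp, of_apply, hr, apply_ite star, star_zero, ite_mul, mul_ite, zero_mul, mul_zero,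
    ← ite_and, map_apply, star_star]
  exact if_congr (by tauto) (mul_comm _ _) rfl

lemma conjTranspose_mul_mul_apply {ι κ : Type*} [Fintype κ] (L : Matrix κ ι ℂ)
    (N : Matrix κ κ ℂ) (a b : ι) :
    (Lᴴ * N * L) a b = ∑ p : κ × κ, star (L p.1 a) * L p.2 b * N p.1 p.2 := by
  simp only [mul_apply, conjTranspose_apply, Finset.sum_mul, Fintype.sum_prod_type]
  rw [Finset.sum_comm]
  exact Finset.sum_congr rfl fun _ _ => Finset.sum_congr rfl fun _ _ => by ring

/-- Partial transposition of an operator conjugated by a local operation on a block that is not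
cut by the transposition. -/
lemma exists_partialTranspose_conj_localOp {d' : Fin m → ℕ} {A B : Finset (Fin m)}
    (h : B ⊆ A ∨ Disjoint B A) (K : Matrix (BlockIdx B d') (BlockIdx B d) ℂ) (N : Op d') :
    ∃ L : Matrix (Idx d') (Idx d) ℂ,
      partialTranspose A ((localOp B K)ᴴ * N * localOp B K) =
        Lᴴ * partialTranspose A N * L := by
  obtain ⟨K', hK'⟩ : ∃ K' : Matrix (BlockIdx B d') (BlockIdx B d) ℂ, ∀ p q a b,
      star (localOp B K (mixIdx A p q) (mixIdx A a b)) *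
        localOp B K (mixIdx A q p) (mixIdx A b a) =
      star (localOp B K' p a) * localOp B K' q b := by
    rcases h with h | h
    · exact ⟨_, conj_localOp_mul_localOp_of_subset h K⟩
    · exact ⟨_, conj_localOp_mul_localOp_of_disjoint h K⟩
  refine ⟨localOp B K', ?_⟩
  ext a b
  rw [partialTranspose_apply, conjTranspose_mul_mul_apply, conjTranspose_mul_mul_apply]
  refine (Fintype.sum_equiv (mixEquiv A) _ _ fun p => ?_).symm
  rw [← hK', partialTranspose_apply]
  rfl

/-- An `X`-LOCC measurement stays positive under partial transposition on a union of blocks. -/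
lemma IsLOCC.posSemidef_partialTranspose {n : ℕ} {X : Partition m} {A : Finset (Fin m)}
    (hA : ∀ B ∈ X.parts, B ⊆ A ∨ Disjoint B A) {M : Fin n → Op d} (hM : IsLOCC X M) (i : Fin n) :
    (partialTranspose A (M i)).PosSemidef := by
  induction hM with
  | output j =>
    dsimp only
    split_ifs
    · rw [partialTranspose_one]
      exact PosSemidef.one
    · exact PosSemidef.zero
  | round B hB r d' hd' K hK N hN ih =>
    rw [partialTranspose_sum]
    refine posSemidef_sum _ fun s _ => ?_
    obtain ⟨L, hL⟩ := exists_partialTranspose_conj_localOp (hA B hB) (K s) (N s i)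
    rw [hL]
    exact (ih s).conjTranspose_mul_mul_same L

lemma localOp_conjTranspose_mul_self {d' : Fin m → ℕ} (A : Finset (Fin m))
    (hd' : ∀ k, k ∉ A → d' k = d k) (K : Matrix (BlockIdx A d') (BlockIdx A d) ℂ) :
    (localOp A K)ᴴ * localOp A K = localOp A (Kᴴ * K) := by
  ext a b
  simp only [mul_apply, conjTranspose_apply, localOp, of_apply]
  split_ifs with hab
  -- Only the intermediate labels that agree with `a` off `A` contribute; `f` parametrizes them by
  -- their part on `A`.
  · let f : BlockIdx A d' → Idx d' := fun p k =>
      if hk : k ∈ A then p ⟨k, hk⟩ else Fin.cast (hd' k hk).symm (a k)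
    have hf : Function.Injective f := fun p q h => by
      funext k
      have := congrFun h k
      simpa [f] using this
    have hfr : ∀ p, (fun k : A => f p k) = p := fun p => by
      funext k
      simp [f]
    have hfo : ∀ p k, k ∉ A → (f p k : ℕ) = a k := fun p k hk => by simp [f, hk]
    refine (Finset.sum_of_injOn f hf.injOn (fun _ _ => Finset.mem_coe.2 (Finset.mem_univ _))
      (fun q _ hq => ?_) fun p _ => ?_).symm
    · rw [if_neg, star_zero, zero_mul]
      intro h
      refine hq ⟨fun k => q k, by simp, ?_⟩
      funext k
      by_cases hk : k ∈ A
      · simp [f, hk]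
      · ext
        simp [f, hk, h k hk]
    · rw [if_pos fun k hk => hfo p k hk, if_pos fun k hk => (hfo p k hk).trans (hab k hk), hfr]
  · refine Finset.sum_eq_zero fun q _ => ?_
    by_cases h : ∀ k, k ∉ A → (q k : ℕ) = a k
    · rw [if_neg fun h' : ∀ k, k ∉ A → (q k : ℕ) = b k =>
        hab fun k hk => (h k hk).symm.trans (h' k hk), mul_zero]
    · rw [if_neg h, star_zero, zero_mul]

lemma localOp_sum {d' : Fin m → ℕ} {κ : Type*} (s : Finset κ) (A : Finset (Fin m))
    (K : κ → Matrix (BlockIdx A d') (BlockIdx A d) ℂ) :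
    localOp A (∑ i ∈ s, K i) = ∑ i ∈ s, localOp A (K i) := by
  ext a b
  simp only [localOp, of_apply, Matrix.sum_apply]
  split_ifs <;> simp

lemma localOp_one (A : Finset (Fin m)) :
    localOp A (1 : Matrix (BlockIdx A d) (BlockIdx A d) ℂ) = 1 := by
  ext a b
  simp only [localOp, of_apply, one_apply, ← ite_and]
  refine if_congr ⟨fun h => ?_, fun h => ?_⟩ rfl rfl
  · funext k
    by_cases hk : k ∈ A
    · exact congrFun h.2 ⟨k, hk⟩
    · exact Fin.ext (h.1 k hk)
  · subst h
    simp

lemma IsLOCC.sum_eq_one {n : ℕ} {X : Partition m} {M : Fin n → Op d} (hM : IsLOCC X M) :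
    ∑ i, M i = 1 := by
  induction hM with
  | output j => simp
  | round B hB r d' hd' K hK N hN ih =>
    rw [Finset.sum_comm]
    simp only [← Matrix.sum_mul, ← Matrix.mul_sum, ih, Matrix.mul_one]
    rw [Finset.sum_congr rfl fun s _ => localOp_conjTranspose_mul_self B (hd' s) (K s),
      ← localOp_sum, hK, localOp_one]

lemma IsLOCC.isMeasurement {n : ℕ} {X : Partition m} {M : Fin n → Op d} (hM : IsLOCC X M) :
    IsMeasurement M where
  posSemidef i := by
    -- The empty set is a union of blocks, and partial transposition on it is the identity.
    have := hM.posSemidef_partialTranspose (A := ∅) (fun B _ => Or.inr (by simp)) i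
    rwa [partialTranspose_empty] at this
  sum_eq_one := hM.sum_eq_one

/-- Makes it possible to turn a guess of `ω(c)` into the guess `z - ω(c)` of the data. -/
lemma IsLOCC.comp_perm {n : ℕ} {X : Partition m} {M : Fin n → Op d} (hM : IsLOCC X M)
    (e : Equiv.Perm (Fin n)) : IsLOCC X (fun i => M (e i)) := by
  induction hM with
  | @output d j =>
    have h : (fun i => if e i = j then (1 : Op d) else 0) =
        fun i => if i = e.symm j then 1 else 0 :=
      funext fun i => if_congr e.eq_symm_apply.symm rfl rfl
    rw [h]
    exact IsLOCC.output (e.symm j)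
  | round B hB r d' hd' K hK N hN ih =>
    exact IsLOCC.round B hB r d' hd' K hK (fun s i => N s (e i)) ih

end PartialTranspose

/-! ### Products of operators -/

section TensorOp

variable {m L : ℕ} {d : Fin m → ℕ}

/-- The product operator `⨂ₗ Q l`, each player holding `L` systems. -/
def tensorOp (Q : Fin L → Op d) : Op (foldDim d L) :=
  Matrix.of fun a b => ∏ l, Q l (copyIdx a l) (copyIdx b l)

lemma tensorOp_apply (Q : Fin L → Op d) (a b : Idx (foldDim d L)) :
    tensorOp Q a b = ∏ l, Q l (copyIdx a l) (copyIdx b l) := rfl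

/-- A label of `L` copies is the family of the labels of the copies. -/
def copyEquiv (d : Fin m → ℕ) (L : ℕ) : Idx (foldDim d L) ≃ (Fin L → Idx d) :=
  (Equiv.piCongrRight fun _ => finFunctionFinEquiv.symm).trans (Equiv.piComm _)

lemma sum_prod_copyIdx (f : Fin L → Idx d → ℂ) :
    ∑ a : Idx (foldDim d L), ∏ l, f l (copyIdx a l) = ∏ l, ∑ p, f l p := by
  rw [Fintype.prod_sum]
  exact Fintype.sum_equiv (copyEquiv d L) _ _ fun _ => rfl

lemma trace_tensorOp (Q : Fin L → Op d) : (tensorOp Q).trace = ∏ l, (Q l).trace :=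
  sum_prod_copyIdx fun l p => Q l p p

lemma tensorOp_mul (Q R : Fin L → Op d) :
    tensorOp Q * tensorOp R = tensorOp fun l => Q l * R l := by
  ext a b
  simp only [mul_apply, tensorOp_apply, ← Finset.prod_mul_distrib]
  exact sum_prod_copyIdx fun l p => Q l (copyIdx a l) p * R l p (copyIdx b l)

lemma tensorOp_eq_zero {Q : Fin L → Op d} (l : Fin L) (h : Q l = 0) : tensorOp Q = 0 := by
  ext a b
  exact Finset.prod_eq_zero (Finset.mem_univ l) (by rw [h]; rfl)

lemma tensorOp_sum {n : ℕ} (T : Fin n → Op d) :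
    tensorOp (fun _ : Fin L => ∑ j, T j) = ∑ c : Fin L → Fin n, tensorOp fun l => T (c l) := by
  ext a b
  simp only [tensorOp_apply, Matrix.sum_apply]
  rw [Fintype.prod_sum]

lemma tensorOp_posSemidef {Q : Fin L → Op d} (hQ : ∀ l, (Q l).PosSemidef) :
    (tensorOp Q).PosSemidef :=
  posSemidef_prod Finset.univ
    (fun l => (Q l).submatrix (fun a => copyIdx a l) fun a => copyIdx a l)
    fun l _ => (hQ l).submatrix _

lemma copyIdx_mixIdx (A : Finset (Fin m)) (a b : Idx (foldDim d L)) (l : Fin L) :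
    copyIdx (mixIdx A a b) l = mixIdx A (copyIdx a l) (copyIdx b l) := by
  funext k
  simp only [copyIdx, mixIdx]
  split_ifs <;> rfl

lemma partialTranspose_tensorOp (A : Finset (Fin m)) (Q : Fin L → Op d) :
    partialTranspose A (tensorOp Q) = tensorOp fun l => partialTranspose A (Q l) := by
  ext a b
  simp only [partialTranspose_apply, tensorOp_apply, copyIdx_mixIdx]

end TensorOp

/-! ### Sums over vectors with a given sum modulo `n` -/

section ModSum

variable {n L : ℕ} [NeZero n]

/-- The deviation of the indicator of `modSum c = i` from its mean. -/
def modWeight (i : Fin n) (c : Fin L → Fin n) : ℝ := (if modSum c = i then 1 else 0) - 1 / (n : ℝ)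

lemma sum_modWeight (c : Fin L → Fin n) : ∑ i, modWeight i c = 0 := by
  have hn : (n : ℝ) ≠ 0 := Nat.cast_ne_zero.2 (NeZero.ne n)
  simp [modWeight, Finset.sum_sub_distrib, hn]

lemma modSum_cons (j : Fin n) (c : Fin L → Fin n) :
    modSum (Fin.cons j c : Fin (L + 1) → Fin n) = j + modSum c := by
  simp [modSum, Fin.sum_univ_succ]

lemma modWeight_cons (i j : Fin n) (c : Fin L → Fin n) :
    modWeight i (Fin.cons j c : Fin (L + 1) → Fin n) = modWeight (i - j) c := by
  simp only [modWeight, modSum_cons, eq_sub_iff_add_eq, add_comm]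

/-- The sums of `∏ₗ t l (c l)` over the vectors `c` with a given sum, up to their mean. -/
def modDeviation (t : Fin L → Fin n → ℂ) (i : Fin n) : ℂ :=
  ∑ c : Fin L → Fin n, (modWeight i c : ℂ) * ∏ l, t l (c l)

lemma sum_modDeviation (t : Fin L → Fin n → ℂ) : ∑ i, modDeviation t i = 0 := by
  simp only [modDeviation]
  rw [Finset.sum_comm]
  refine Finset.sum_eq_zero fun c _ => ?_
  rw [← Finset.sum_mul, ← Complex.ofReal_sum, sum_modWeight]
  simp

/-- Splitting off the first entry of `c` exhibits a convolution over the integers mod `n`. -/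
lemma modDeviation_succ (t : Fin (L + 1) → Fin n → ℂ) (i : Fin n) :
    modDeviation t i = ∑ j, t 0 j * modDeviation (fun l => t l.succ) (i - j) := by
  simp only [modDeviation]
  rw [← (Fin.consEquiv fun _ : Fin (L + 1) => Fin n).sum_comp, Fintype.sum_prod_type]
  refine Finset.sum_congr rfl fun j _ => ?_
  rw [Finset.mul_sum]
  refine Finset.sum_congr rfl fun c _ => ?_
  have h : modWeight i ((Fin.consEquiv fun _ : Fin (L + 1) => Fin n) (j, c)) =
      modWeight (i - j) c := modWeight_cons i j c
  simp only [h, Fin.consEquiv_apply, Fin.prod_univ_succ, Fin.cons_zero, Fin.cons_succ]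
  ring

/-- Each factor `t l` may be replaced by `t l 0 - t l`, up to a sign. -/
lemma modDeviation_reflect (t : Fin L → Fin n → ℂ) (i : Fin n) :
    modDeviation t i = (-1) ^ L * modDeviation (fun l j => t l 0 - t l j) i := by
  induction L generalizing i with
  | zero => simp [modDeviation]
  | succ L ih =>
    rw [modDeviation_succ, modDeviation_succ]
    set F := modDeviation fun (l : Fin L) j => t l.succ 0 - t l.succ j
    -- This kills the constant `t 0 0` in the convolution, so that only `-t 0 j` survives.
    have h : ∑ j, F (i - j) = 0 := by
      rw [← sum_modDeviation fun (l : Fin L) j => t l.succ 0 - t l.succ j]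
      exact (Equiv.subLeft i).sum_comp F
    have ht : ∀ k, modDeviation (fun l => t l.succ) k = (-1) ^ L * F k := ih _
    change _ = (-1) ^ (L + 1) * ∑ j, (t 0 0 - t 0 j) * F (i - j)
    simp only [ht, sub_mul, Finset.sum_sub_distrib]
    rw [← Finset.mul_sum, h, pow_succ, mul_zero, zero_sub, mul_neg, mul_neg_one, neg_mul, neg_neg,
      Finset.mul_sum]
    exact Finset.sum_congr rfl fun j _ => by ring

/-- The values are `1 - 1/n` and `-1/n`; the former is larger in absolute value because `n ≥ 2`. -/
lemma abs_modWeight_le (hn : 2 ≤ n) (i : Fin n) (c : Fin L → Fin n) :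
    |modWeight i c| ≤ ((n : ℝ) - 1) / n := by
  have h2 : (2 : ℝ) ≤ n := by exact_mod_cast hn
  have h : ((n : ℝ) - 1) / n = 1 - 1 / n := by field_simp
  have h' : 1 / (n : ℝ) ≤ 1 / 2 := one_div_le_one_div_of_le (by norm_num) h2
  have h'' : 0 ≤ 1 / (n : ℝ) := by positivity
  rw [h, modWeight, abs_le]
  split_ifs <;> constructor <;> linarith

end ModSum

/-! ### Multi-fold operators -/

section FoldOp

variable {m n : ℕ} [NeZero n] {d : Fin m → ℕ}

/-- The sum of the operators `⨂ₗ T (c l)` over the vectors `c` with sum `i` modulo `n`. -/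
def foldOp (T : Fin n → Op d) (L : ℕ) (i : Fin n) : Op (foldDim d L) :=
  ∑ c : Fin L → Fin n with modSum c = i, tensorOp fun l => T (c l)

lemma sum_foldOp (T : Fin n → Op d) (L : ℕ) :
    ∑ i, foldOp T L i = tensorOp fun _ => ∑ j, T j := by
  rw [tensorOp_sum]
  exact Finset.sum_fiberwise _ _ _

lemma foldOp_posSemidef {T : Fin n → Op d} (hT : ∀ i, (T i).PosSemidef) (L : ℕ) (i : Fin n) :
    (foldOp T L i).PosSemidef :=
  posSemidef_sum _ fun c _ => tensorOp_posSemidef fun l => hT (c l)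

lemma foldOp_mul_foldOp {T : Fin n → Op d} (hT : ∀ i j, i ≠ j → T i * T j = 0) (L : ℕ)
    {i j : Fin n} (hij : i ≠ j) : foldOp T L i * foldOp T L j = 0 := by
  simp only [foldOp, Finset.sum_mul, Finset.mul_sum, tensorOp_mul]
  refine Finset.sum_eq_zero fun c hc => Finset.sum_eq_zero fun c' hc' => ?_
  have hne : c' ≠ c := by
    rintro rfl
    exact hij ((Finset.mem_filter.1 hc').2.symm.trans (Finset.mem_filter.1 hc).2)
  obtain ⟨l, hl⟩ := Function.ne_iff.1 hne
  exact tensorOp_eq_zero l (hT _ _ hl)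

lemma partialTranspose_foldOp (A : Finset (Fin m)) (T : Fin n → Op d) (L : ℕ) (i : Fin n) :
    partialTranspose A (foldOp T L i) = foldOp (fun j => partialTranspose A (T j)) L i := by
  simp only [foldOp, partialTranspose_sum, partialTranspose_tensorOp]

/-- The mean `1/n` of the indicator yields the full tensor power; the rest is `modDeviation_reflect`
applied to each matrix entry. -/
lemma foldOp_eq (T : Fin n → Op d) (L : ℕ) (i : Fin n) :
    foldOp T L i = (1 / n : ℂ) • tensorOp (fun _ => ∑ j, T j) +
      ∑ c : Fin L → Fin n, (((-1) ^ L * modWeight i c : ℝ) : ℂ) •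
        tensorOp fun l => T 0 - T (c l) := by
  ext a b
  have h := modDeviation_reflect (fun l j => T j (copyIdx a l) (copyIdx b l)) i
  simp only [modDeviation, modWeight] at h
  rw [tensorOp_sum]
  simp only [foldOp, Matrix.add_apply, Matrix.smul_apply, Matrix.sum_apply, tensorOp_apply,
    Matrix.sub_apply, smul_eq_mul, Finset.sum_filter, modWeight]
  push_cast at h ⊢
  rw [Finset.mul_sum] at h
  simp only [mul_assoc]
  rw [← h, Finset.mul_sum, ← Finset.sum_add_distrib]
  refine Finset.sum_congr rfl fun c _ => ?_
  split_ifs <;> push_cast <;> ring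

/-- An operator that dominates all the multi-fold operators if `T 0` dominates all the `T j`. -/
def foldBound (T : Fin n → Op d) (L : ℕ) : Op (foldDim d L) :=
  (1 / n : ℂ) • tensorOp (fun _ => ∑ j, T j) +
    (((n : ℝ) - 1) / n : ℂ) • tensorOp fun _ => ∑ j, (T 0 - T j)

lemma foldBound_sub_foldOp_posSemidef (hn : 2 ≤ n) {T : Fin n → Op d}
    (hT : ∀ i, (T 0 - T i).PosSemidef) (L : ℕ) (i : Fin n) :
    (foldBound T L - foldOp T L i).PosSemidef := by
  have h : foldBound T L - foldOp T L i = ∑ c : Fin L → Fin n,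
      ((((n : ℝ) - 1) / n - (-1) ^ L * modWeight i c : ℝ) : ℂ) •
        tensorOp fun l => T 0 - T (c l) := by
    rw [foldOp_eq, foldBound, tensorOp_sum fun j => T 0 - T j, add_sub_add_left_eq_sub,
      Finset.smul_sum, ← Finset.sum_sub_distrib]
    refine Finset.sum_congr rfl fun c _ => ?_
    rw [← sub_smul]
    push_cast
    rfl
  rw [h]
  refine posSemidef_sum _ fun c _ =>
    posSemidef_real_smul (tensorOp_posSemidef fun l => hT (c l)) ?_
  have h1 := abs_modWeight_le hn i c
  have h2 : |(-1 : ℝ) ^ L * modWeight i c| ≤ ((n : ℝ) - 1) / n := by simpa [abs_mul] using h1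
  linarith [le_abs_self ((-1 : ℝ) ^ L * modWeight i c)]

lemma trace_foldBound (T : Fin n → Op d) (L : ℕ) :
    (foldBound T L).trace = 1 / n * (∑ j, (T j).trace) ^ L +
      ((n : ℝ) - 1) / n * (n * (T 0).trace - ∑ j, (T j).trace) ^ L := by
  have h : (∑ j, (T 0 - T j)).trace = n * (T 0).trace - ∑ j, (T j).trace := by
    rw [trace_sum]
    simp [trace_sub]
  simp only [foldBound, trace_add, trace_smul, trace_tensorOp, h, Finset.prod_const,
    Finset.card_univ, Fintype.card_fin, smul_eq_mul]
  rw [trace_sum]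

/-- The success probability of a measurement that stays positive under partial transposition. -/
lemma sum_trace_foldOp_le (hn : 2 ≤ n) {q : Fin n → Op d} {p : ℝ} (hq : ∑ j, (q j).trace = 1)
    (hp : (q 0).trace = p) (A : Finset (Fin m))
    (hdom : ∀ i, (partialTranspose A (q 0) - partialTranspose A (q i)).PosSemidef) (L : ℕ)
    {M : Fin n → Op (foldDim d L)} (hM : ∀ i, (partialTranspose A (M i)).PosSemidef)
    (hsum : ∑ i, M i = 1) :
    ∑ i, (foldOp q L i * M i).trace.re ≤
      1 / (n : ℝ) + ((n : ℝ) - 1) / n * (n * p - 1) ^ L := by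
  set T : Fin n → Op d := fun j => partialTranspose A (q j)
  have h1 : ∀ i, (foldOp q L i * M i).trace.re ≤
      (foldBound T L * partialTranspose A (M i)).trace.re := fun i => by
    rw [← trace_partialTranspose_mul A, partialTranspose_foldOp]
    have := re_trace_mul_nonneg (foldBound_sub_foldOp_posSemidef (T := T) hn hdom L i) (hM i)
    rw [sub_mul, trace_sub, Complex.sub_re] at this
    linarith
  -- As `foldBound` does not depend on `i`, summing the `M i` to `1` leaves its trace.
  refine (Finset.sum_le_sum fun i _ => h1 i).trans (le_of_eq ?_)
  rw [← Complex.re_sum, ← trace_sum, ← Finset.mul_sum, ← partialTranspose_sum, hsum,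
    partialTranspose_one, mul_one, trace_foldBound]
  simp only [T, trace_partialTranspose, hq, hp]
  rw [one_pow]
  have : (1 / n * 1 + ((n : ℝ) - 1) / n * (n * p - 1) ^ L : ℂ) =
      ((1 / (n : ℝ) + ((n : ℝ) - 1) / n * (n * p - 1) ^ L : ℝ) : ℂ) := by
    push_cast
    ring
  rw [this, Complex.ofReal_re]

end FoldOp

/-! ### Multi-fold ensembles -/

section Ensembles

variable {m n : ℕ} {d : Fin m → ℕ}

/-- The weighted state `ηᵢ ρᵢ`. -/
def Ensemble.weighted (E : Ensemble d n) (i : Fin n) : Op d := (E.prob i : ℂ) • E.state i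

lemma Ensemble.weighted_posSemidef (E : Ensemble d n) (i : Fin n) : (E.weighted i).PosSemidef :=
  posSemidef_real_smul (E.state_posSemidef i) (E.prob_nonneg i)

lemma Ensemble.trace_weighted (E : Ensemble d n) (i : Fin n) :
    (E.weighted i).trace = E.prob i := by
  simp [weighted, E.state_trace]

lemma Ensemble.sum_trace_weighted (E : Ensemble d n) : ∑ i, (E.weighted i).trace = 1 := by
  simp only [E.trace_weighted]
  exact_mod_cast E.prob_sum

lemma Ensemble.weighted_mul_weighted {E : Ensemble d n} (hE : E.IsOrthogonal) (i j : Fin n)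
    (hij : i ≠ j) : E.weighted i * E.weighted j = 0 := by
  simp [weighted, hE i j hij]

lemma Ensemble.vecProb_smul_vecState (E : Ensemble d n) {L : ℕ} (c : Fin L → Fin n) :
    (vecProb E.prob c : ℂ) • vecState E.state c = tensorOp fun l => E.weighted (c l) := by
  ext a b
  simp [vecProb, vecState, tensorOp_apply, weighted, Finset.prod_mul_distrib]

lemma vecProb_nonneg (E : Ensemble d n) {L : ℕ} (c : Fin L → Fin n) : 0 ≤ vecProb E.prob c :=
  Finset.prod_nonneg fun l _ => E.prob_nonneg (c l)

variable [NeZero n]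

lemma ensembleScheme_eq_foldOp (E : Ensemble d n) (L : ℕ) (x z : Fin n) :
    ensembleScheme E L x z = foldOp E.weighted L (z - x) := by
  simp only [ensembleScheme, foldOp, E.vecProb_smul_vecState, eq_sub_iff_add_eq, add_comm]

lemma foldProb_smul_foldState (E : Ensemble d n) (L : ℕ) (i : Fin n) :
    (foldProb E.prob L i : ℂ) • foldState E.prob E.state L i = foldOp E.weighted L i := by
  by_cases h : foldProb E.prob L i = 0
  -- A vanishing total weight forces every `vecProb` in it to vanish, so the default value of
  -- `foldState` plays no role.
  · have h' := (Finset.sum_eq_zero_iff_of_nonneg fun c _ => vecProb_nonneg E c).1 h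
    rw [h, Complex.ofReal_zero, zero_smul]
    refine (Finset.sum_eq_zero fun c hc => ?_).symm
    rw [← E.vecProb_smul_vecState, h' c hc, Complex.ofReal_zero, zero_smul]
  · rw [foldState, smul_smul, mul_inv_cancel₀ (by exact_mod_cast h), one_smul]
    simp only [foldOp, E.vecProb_smul_vecState]

lemma successProb_fold (E : Ensemble d n) (L : ℕ) (M : Fin n → Op (foldDim d L)) :
    successProb (foldProb E.prob L) (foldState E.prob E.state L) M =
      ∑ i, (foldOp E.weighted L i * M i).trace.re := by
  refine Finset.sum_congr rfl fun i _ => ?_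
  rw [← foldProb_smul_foldState, smul_mul_assoc, trace_smul, smul_eq_mul, Complex.re_ofReal_mul]

lemma sum_trace_foldOp (E : Ensemble d n) (L : ℕ) :
    ∑ i, (foldOp E.weighted L i).trace = 1 := by
  rw [← trace_sum, sum_foldOp, trace_tensorOp]
  simp [trace_sum, E.sum_trace_weighted]

lemma sum_re_trace_foldOp (E : Ensemble d n) (L : ℕ) :
    ∑ i, (foldOp E.weighted L i).trace.re = 1 := by
  rw [← Complex.re_sum, sum_trace_foldOp, Complex.one_re]

lemma IsMeasurement.successProb_fold_le_one (E : Ensemble d n) (L : ℕ)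
    {M : Fin n → Op (foldDim d L)} (hM : IsMeasurement M) :
    successProb (foldProb E.prob L) (foldState E.prob E.state L) M ≤ 1 := by
  rw [successProb_fold, ← sum_re_trace_foldOp E L]
  refine Finset.sum_le_sum fun i _ => ?_
  have h : (1 - M i).PosSemidef := by
    rw [← hM.sum_eq_one, ← Finset.add_sum_erase _ _ (Finset.mem_univ i), add_sub_cancel_left]
    exact posSemidef_sum _ fun j _ => hM.posSemidef j
  have := re_trace_mul_nonneg (foldOp_posSemidef E.weighted_posSemidef L i) h
  rw [mul_sub, mul_one, trace_sub, Complex.sub_re] at this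
  linarith

lemma bddAbove_successProb_fold (E : Ensemble d n) (L : ℕ) {S : Set (Fin n → Op (foldDim d L))}
    (hS : ∀ M ∈ S, IsMeasurement M) :
    BddAbove (successProb (foldProb E.prob L) (foldState E.prob E.state L) '' S) :=
  ⟨1, by
    rintro _ ⟨M, hM, rfl⟩
    exact (hS M hM).successProb_fold_le_one E L⟩

/-- Mutually orthogonal states are discriminated perfectly by a global measurement. -/
lemma exists_perfect_measurement {E : Ensemble d n} (hE : E.IsOrthogonal) (L : ℕ) :
    ∃ M : Fin n → Op (foldDim d L), IsMeasurement M ∧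
      ∀ i, foldOp E.weighted L i * M i = foldOp E.weighted L i := by
  obtain ⟨M, h1, h2, h3⟩ := exists_discriminating_measurement 0 (foldOp E.weighted L)
    (fun i => (foldOp_posSemidef E.weighted_posSemidef L i).isHermitian)
    fun i j hij => foldOp_mul_foldOp (Ensemble.weighted_mul_weighted hE) L hij
  exact ⟨M, ⟨h1, h2⟩, h3⟩

lemma optSuccess_global_eq_one {E : Ensemble d n} (hE : E.IsOrthogonal) (L : ℕ) :
    optSuccess (globalMeasurements (foldDim d L) n)
      (foldProb E.prob L) (foldState E.prob E.state L) = 1 := by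
  obtain ⟨M, hM, hMq⟩ := exists_perfect_measurement hE L
  refine IsGreatest.csSup_eq ⟨⟨M, hM, ?_⟩, ?_⟩
  · rw [successProb_fold]
    simp only [hMq]
    exact sum_re_trace_foldOp E L
  · rintro _ ⟨N, hN, rfl⟩
    exact IsMeasurement.successProb_fold_le_one E L hN

/-- The guessing probability for given data is a success probability of relabelled
measurements. -/
lemma sum_recoverProb (E : Ensemble d n) (L : ℕ) (M : Fin n → Fin n → Op (foldDim d L)) :
    ∑ x, recoverProb (ensembleScheme E L) M x =
      ∑ z, successProb (foldProb E.prob L) (foldState E.prob E.state L)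
        fun i => M z (Equiv.subLeft z i) := by
  simp only [recoverProb, successProb_fold, ensembleScheme_eq_foldOp]
  rw [Finset.sum_comm]
  refine Finset.sum_congr rfl fun z _ => ?_
  rw [← (Equiv.subLeft z).sum_comp]
  simp [Equiv.subLeft]

/-- Broadcasting the shifted data reduces guessing to the discrimination of the multi-fold
ensemble. -/
lemma optRecover_eq_optSuccess (E : Ensemble d n) (L : ℕ) {S : Set (Fin n → Op (foldDim d L))}
    (hne : S.Nonempty) (hS : ∀ M ∈ S, IsMeasurement M)
    (hperm : ∀ M ∈ S, ∀ e : Equiv.Perm (Fin n), (fun i => M (e i)) ∈ S) :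
    optRecover S (ensembleScheme E L) =
      optSuccess S (foldProb E.prob L) (foldState E.prob E.state L) := by
  have hn : (n : ℝ) ≠ 0 := Nat.cast_ne_zero.2 (NeZero.ne n)
  have hb := bddAbove_successProb_fold E L hS
  set v := successProb (foldProb E.prob L) (foldState E.prob E.state L)
  have hval : ∀ M : Fin n → Fin n → Op (foldDim d L), (∀ z, M z ∈ S) →
      1 / (n : ℝ) * ∑ x, recoverProb (ensembleScheme E L) M x ≤ sSup (v '' S) := fun M hM => by
    rw [sum_recoverProb]
    calc 1 / (n : ℝ) * ∑ z, v (fun i => M z (Equiv.subLeft z i))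
        ≤ 1 / (n : ℝ) * ∑ _z : Fin n, sSup (v '' S) := by
          gcongr with z
          exact le_csSup hb ⟨_, hperm _ (hM z) _, rfl⟩
      _ = sSup (v '' S) := by simp [hn]
  obtain ⟨M₀, hM₀⟩ := hne
  refine le_antisymm (csSup_le ⟨_, fun _ => M₀, fun _ => hM₀, rfl⟩ ?_)
    (csSup_le ⟨_, M₀, hM₀, rfl⟩ ?_)
  · rintro _ ⟨M, hM, rfl⟩
    exact hval M hM
  · rintro _ ⟨N, hN, rfl⟩
    -- The strategy that guesses `z` minus the outcome of `N` achieves the value of `N` for every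
    -- `z`.
    refine le_csSup ⟨sSup (v '' S), ?_⟩
      ⟨fun z i => N (Equiv.subLeft z i), fun z => hperm N hN _, ?_⟩
    · rintro _ ⟨M, hM, rfl⟩
      exact hval M hM
    · dsimp only
      rw [sum_recoverProb]
      simp [Equiv.subLeft, hn]

/-- Always announcing `i` is LOCC and succeeds with probability `η_i^(L)`; these probabilities sum
to `1`. -/
lemma one_div_le_optSuccess_locc (E : Ensemble d n) (L : ℕ) (X : Partition m) :
    1 / (n : ℝ) ≤ optSuccess (loccMeasurements X (foldDim d L) n)
      (foldProb E.prob L) (foldState E.prob E.state L) := by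
  have hn : (0 : ℝ) < n := Nat.cast_pos.2 (NeZero.pos n)
  have hb := bddAbove_successProb_fold E L (S := loccMeasurements X (foldDim d L) n)
    fun M hM => IsLOCC.isMeasurement hM
  have h : ∀ i, (foldOp E.weighted L i).trace.re ≤
      optSuccess (loccMeasurements X (foldDim d L) n)
        (foldProb E.prob L) (foldState E.prob E.state L) := fun i => by
    refine le_csSup hb ⟨_, IsLOCC.output i, ?_⟩
    rw [successProb_fold, Finset.sum_eq_single i (fun j _ hj => by simp [hj]) (by simp)]
    simp
  have := Finset.sum_le_sum fun i (_ : i ∈ Finset.univ) => h i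
  rw [sum_re_trace_foldOp] at this
  rw [div_le_iff₀' hn]
  simpa using this

end Ensembles

/-! ### Bipartitions -/

section Bipartitions

variable {m : ℕ}

/-- The partition of the players into a block and its complement. -/
def complPartition (A : Finset (Fin m)) (hA : A ≠ ⊥) (hA' : Aᶜ ≠ ⊥) : Partition m :=
  (Finpartition.indiscrete hA).extend hA' disjoint_compl_right (sup_compl_eq_top)

lemma mem_complPartition {A B : Finset (Fin m)} {hA : A ≠ ⊥} {hA' : Aᶜ ≠ ⊥} :
    B ∈ (complPartition A hA hA').parts ↔ B = Aᶜ ∨ B = A := by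
  simp [complPartition]

lemma isBipartition_complPartition {A : Finset (Fin m)} (hA : A ≠ ⊥) (hA' : Aᶜ ≠ ⊥) :
    IsBipartition (complPartition A hA hA') := by
  have h : (complPartition A hA hA').parts = {Aᶜ, A} := by
    ext B
    simp [mem_complPartition]
  rw [IsBipartition, h, Finset.card_pair]
  intro h
  have := disjoint_compl_right (a := A)
  rw [h, disjoint_self] at this
  exact hA this

/-- Domination for bipartitions yields domination on a union of blocks of a nontrivial
partition. -/
lemma exists_dominated_union {n : ℕ} [NeZero n] {d : Fin m → ℕ} {E : Ensemble d n}
    (hX : ∀ X : Partition m, IsBipartition X → PTDominated E X) {X : Partition m}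
    (h : IsNontrivial X) :
    ∃ A : Finset (Fin m), (∀ B ∈ X.parts, B ⊆ A ∨ Disjoint B A) ∧
      ∀ i, (partialTranspose A (E.weighted 0) - partialTranspose A (E.weighted i)).PosSemidef := by
  obtain ⟨A, hA, A', hA', hne⟩ := Finset.one_lt_card.1 h
  have hdisj : Disjoint A' A := X.disjoint hA' hA hne.symm
  have hAb : A ≠ ⊥ := X.ne_bot hA
  have hAc : Aᶜ ≠ ⊥ := fun h0 => X.ne_bot hA'
    (le_bot_iff.1 (h0 ▸ (le_compl_iff_disjoint_right.2 hdisj)))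
  -- `C` may be `A` or its complement; both are unions of blocks of `X`.
  obtain ⟨C, hC, hdom⟩ := hX _ (isBipartition_complPartition hAb hAc)
  refine ⟨C, fun B hB => ?_, fun i => ?_⟩
  · rw [mem_complPartition] at hC
    by_cases hBA : B = A
    · subst hBA
      rcases hC with rfl | rfl
      · exact Or.inr disjoint_compl_right
      · exact Or.inl subset_rfl
    · have hBd : Disjoint B A := X.disjoint hB hA hBA
      rcases hC with rfl | rfl
      · exact Or.inl (le_compl_iff_disjoint_right.2 hBd)
      · exact Or.inr hBd
  · by_cases hi : i = 0
    · rw [hi, sub_self]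
      exact PosSemidef.zero
    · exact hdom i hi

end Bipartitions

/-! ### Bounds on LOCC discrimination and the hiding limit -/

section Hiding

variable {m n : ℕ} [NeZero n] {d : Fin m → ℕ} {E : Ensemble d n}

lemma optSuccess_locc_le (hn : 2 ≤ n) (hX : ∀ X : Partition m, IsBipartition X → PTDominated E X)
    {X : Partition m} (h : IsNontrivial X) (L : ℕ) :
    optSuccess (loccMeasurements X (foldDim d L) n)
        (foldProb E.prob L) (foldState E.prob E.state L) ≤
      1 / (n : ℝ) + ((n : ℝ) - 1) / n * (n * E.prob 0 - 1) ^ L := by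
  obtain ⟨A, hA, hdom⟩ := exists_dominated_union hX h
  refine csSup_le ⟨_, _, IsLOCC.output 0, rfl⟩ ?_
  rintro _ ⟨M, hM, rfl⟩
  rw [successProb_fold]
  exact sum_trace_foldOp_le hn E.sum_trace_weighted (E.trace_weighted 0) A hdom L
    (fun i => IsLOCC.posSemidef_partialTranspose hA hM i) (IsLOCC.sum_eq_one hM)

/-- Traces of the domination give `η_i ≤ η_0`; sum over `i`. This makes the base `n η_0 - 1` of the
exponential bound nonnegative. -/
lemma one_le_mul_prob_zero (hX : ∀ X : Partition m, IsBipartition X → PTDominated E X)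
    {X : Partition m} (h : IsNontrivial X) : 1 ≤ n * E.prob 0 := by
  obtain ⟨A, -, hdom⟩ := exists_dominated_union hX h
  have hle : ∀ i, E.prob i ≤ E.prob 0 := fun i => by
    have := (hdom i).trace_nonneg
    rw [trace_sub, trace_partialTranspose, trace_partialTranspose, E.trace_weighted,
      E.trace_weighted, sub_nonneg] at this
    exact_mod_cast this
  have := Finset.sum_le_sum fun i (_ : i ∈ Finset.univ) => hle i
  rw [E.prob_sum] at this
  simpa using this

lemma optRecover_locc (E : Ensemble d n) (L : ℕ) (X : Partition m) :
    optRecover (loccMeasurements X (foldDim d L) n) (ensembleScheme E L) =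
      optSuccess (loccMeasurements X (foldDim d L) n)
        (foldProb E.prob L) (foldState E.prob E.state L) :=
  optRecover_eq_optSuccess E L ⟨_, IsLOCC.output 0⟩ (fun _ hM => IsLOCC.isMeasurement hM)
    fun _ hM e => IsLOCC.comp_perm hM e

lemma isDataHidingScheme_ensembleScheme (hn : 2 ≤ n) (hE : E.IsOrthogonal)
    (h0 : E.prob 0 < 2 / (n : ℝ))
    (hX : ∀ X : Partition m, IsBipartition X → PTDominated E X) :
    IsDataHidingScheme (foldDim d) (ensembleScheme E) where
  posSemidef L _ x z := by
    rw [ensembleScheme_eq_foldOp]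
    exact foldOp_posSemidef E.weighted_posSemidef L _
  trace_sum L _ x := by
    simp only [ensembleScheme_eq_foldOp]
    rw [← sum_trace_foldOp E L]
    exact (Equiv.subRight x).sum_comp fun i => (foldOp E.weighted L i).trace
  accessible L _ := by
    obtain ⟨M, hM, hMq⟩ := exists_perfect_measurement hE L
    refine ⟨fun z x => M (z - x), fun z => ⟨fun x => hM.posSemidef _, ?_⟩, fun x => ?_⟩
    · rw [← hM.sum_eq_one]
      exact (Equiv.subLeft z).sum_comp M
    · simp only [recoverProb, ensembleScheme_eq_foldOp, hMq]
      rw [← sum_re_trace_foldOp E L]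
      exact (Equiv.subRight x).sum_comp fun i => (foldOp E.weighted L i).trace.re
  hidden X h := by
    have hpos : (0 : ℝ) < n := Nat.cast_pos.2 (NeZero.pos n)
    -- The assumption `η_0 < 2/n` is exactly what makes the powers tend to zero.
    have hlt : (n : ℝ) * E.prob 0 - 1 < 1 := by
      rw [lt_div_iff₀ hpos] at h0
      linarith
    have hnn : 0 ≤ (n : ℝ) * E.prob 0 - 1 := sub_nonneg.2 (one_le_mul_prob_zero hX h)
    have hlim : Tendsto (fun L : ℕ => 1 / (n : ℝ) + ((n : ℝ) - 1) / n * (n * E.prob 0 - 1) ^ L)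
        atTop (𝓝 (1 / (n : ℝ))) := by
      simpa using ((tendsto_pow_atTop_nhds_zero_of_lt_one hnn hlt).const_mul
        (((n : ℝ) - 1) / n)).const_add (1 / (n : ℝ))
    simp only [optRecover_locc]
    exact tendsto_of_tendsto_of_tendsto_of_le_of_le tendsto_const_nhds hlim
      (fun L => one_div_le_optSuccess_locc E L X) fun L => optSuccess_locc_le hn hX h L

end Hiding

end DataHiding

end

theorem corollary3 {m n : ℕ} [NeZero n] (hm : 2 ≤ m) (hn : 2 ≤ n) (d : Fin m → ℕ)
    (hd : ∀ k, 0 < d k) (E : Ensemble d n) (hE : E.IsOrthogonal)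
    (h0 : E.prob 0 < 2 / (n : ℝ))
    (hX : ∀ X : Partition m, IsBipartition X → PTDominated E X) :
    IsDataHidingScheme (foldDim d) (ensembleScheme E) ∧
    (∀ L : ℕ, 1 ≤ L → ∀ X : Partition m,
      optRecover (loccMeasurements X (foldDim d L) n) (ensembleScheme E L) =
        optSuccess (loccMeasurements X (foldDim d L) n)
          (foldProb E.prob L) (foldState E.prob E.state L)) ∧
    (∀ L : ℕ, 1 ≤ L →
      optSuccess (globalMeasurements (foldDim d L) n)
        (foldProb E.prob L) (foldState E.prob E.state L) = 1) ∧
    (∀ X : Partition m, IsNontrivial X → ∀ L : ℕ, 1 ≤ L →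
      1 / (n : ℝ) ≤ optSuccess (loccMeasurements X (foldDim d L) n)
          (foldProb E.prob L) (foldState E.prob E.state L) ∧
      optSuccess (loccMeasurements X (foldDim d L) n)
          (foldProb E.prob L) (foldState E.prob E.state L) ≤
        1 / (n : ℝ) + ((n : ℝ) - 1) / n * (n * E.prob 0 - 1) ^ L) := by

  exact ⟨isDataHidingScheme_ensembleScheme hn hE h0 hX, fun L _ X => optRecover_locc E L X,
    fun L _ => optSuccess_global_eq_one hE L,
    fun X h L _ => ⟨one_div_le_optSuccess_locc E L X, optSuccess_locc_le hn hX h L⟩⟩
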